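/- For integers $1\le k\le n$, let $S_{n,k}\in\{0,1\}^{\binom nk\times n}$ be the matrix whose rows are all the vectors in $\{0,1\}^n$ with exactly $k$ ones, each appearing exactly once. For $m\ge 0$, a margin-$m$ embedding of a matrix $A\in\{0,1\}^{N\times n}$ in dimension $d$ consists of unit vectors $U_1,\dots,U_N,V_1,\dots,V_n\in\mathbb R^d$ such that $\langle U_j,V_i\rangle\ge m$ whenever $A_{ji}=1$ and $\langle U_j,V_i\rangle\le -m$ whenever $A_{ji}=0$. There is an absolute constant $c>0$ such that for every $\gamma<1$ there is a constant $C>0$, depending only on $\gamma$, with the following property: for all integers $n$ and $k$ with $1\le k\le\gamma n$, and for every integer $d\ge Ck\log(n/k)$, the matrix $S_{n,k}$ has a margin-$c/\sqrt k$ embedding in dimension $d$. (For instance, with $\gamma=1/2$, the constants $c$ and $C$ are absolute for all $1\le k\le n/2$.) -/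

import Mathlib

/-- A margin-`m`, relative-bias-`τ` embedding in dimension `d` of the incidence matrix `A`
(rows are queries, columns are objects): unit vectors `U j` for the queries and `V i` for the
objects with `⟪U j, V i⟫ ≥ τ + m` if `A j i = 1` and `⟪U j, V i⟫ ≤ τ - m` if `A j i = 0`. -/
structure IsMarginEmbedding {Q O : Type*} {d : ℕ} (A : Matrix Q O (Fin 2))
    (U : Q → EuclideanSpace ℝ (Fin d)) (V : O → EuclideanSpace ℝ (Fin d)) (m τ : ℝ) :
    Prop where
  margin_nonneg : 0 ≤ m
  norm_query : ∀ j, ‖U j‖ = 1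
  norm_object : ∀ i, ‖V i‖ = 1
  relevant : ∀ j i, A j i = 1 → τ + m ≤ inner ℝ (U j) (V i)
  irrelevant : ∀ j i, A j i = 0 → inner ℝ (U j) (V i) ≤ τ - m

/-- The matrix `S_{n,k}` with `n` columns that contains every 0/1 row with exactly `k` ones exactly
once: its rows are indexed by the `k`-element subsets of the columns, and the row of `T` is the
indicator of `T`. -/
def topKMatrix (n k : ℕ) : Matrix {T : Finset (Fin n) // T.card = k} (Fin n) (Fin 2) :=
  fun T i => if i ∈ T.1 then 1 else 0

/-! If n ≤ 8k, orthonormal columns already work. Otherwise take the columns to be random sign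
vectors with one extra constant coordinate. Fix T and flip the sign of the columns off T. By the
perceptron argument (`exists_multiset_norm_sum_sq_le`), failure of margin 1/(32√k) yields m = 289k
signed columns, with repetition, whose sum has squared norm at most 4m. This is impossible
(`lower_bound_signedCount`): a multiplicity vector far from balanced between T and its complement is
large in the constant coordinate; otherwise it has mass over m/3 on only k indices, so its ℓ² norm
is large, and the sign matrix preserves that norm up to a constant. As m is proportional to k, only
exp(O(k log(n/k))) pairs (T, multiset) occur, so a union bound gives one sign matrix for all of them
(`exists_sign_matrix`). -/

/-! ### Moments and lower tail of random signed sums -/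

/-- The real sign of a Boolean. -/
def boolSign (b : Bool) : ℝ := if b then 1 else -1

theorem boolSign_sq (b : Bool) : boolSign b ^ 2 = 1 := by
  cases b <;> simp [boolSign]

/-- The signed sum of the entries of `y` with signs `ε`. -/
def signedSum {n : ℕ} (ε : Fin n → Bool) (y : Fin n → ℝ) : ℝ := ∑ i, boolSign (ε i) * y i

theorem sum_bool_fun_succ {n : ℕ} (f : (Fin (n + 1) → Bool) → ℝ) :
    ∑ ε, f ε = ∑ ε : Fin n → Bool, (f (Fin.cons true ε) + f (Fin.cons false ε)) := by
  rw [← (Fin.consEquiv (fun _ : Fin (n + 1) => Bool)).sum_comp, Fintype.sum_prod_type]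
  simp [Finset.sum_add_distrib, Fin.consEquiv]

theorem signedSum_cons {n : ℕ} (b : Bool) (ε : Fin n → Bool) (y : Fin (n + 1) → ℝ) :
    signedSum (Fin.cons b ε) y = boolSign b * y 0 + signedSum ε (fun i => y i.succ) := by
  simp [signedSum, Fin.sum_univ_succ]

theorem sum_signedSum_sq {n : ℕ} (y : Fin n → ℝ) :
    ∑ ε, signedSum ε y ^ 2 = 2 ^ n * ∑ i, y i ^ 2 := by
  induction n with
  | zero => simp [signedSum]
  | succ n ih =>
    rw [sum_bool_fun_succ, Fin.sum_univ_succ]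
    have h : ∀ ε : Fin n → Bool, signedSum (Fin.cons true ε) y ^ 2
        + signedSum (Fin.cons false ε) y ^ 2
        = 2 * y 0 ^ 2 + 2 * signedSum ε (fun i => y i.succ) ^ 2 := by
      intro ε
      simp only [signedSum_cons, boolSign, if_true, Bool.false_eq_true, if_false]
      ring
    simp only [h, Finset.sum_add_distrib, ← Finset.mul_sum, ih]
    simp
    ring

theorem sum_signedSum_pow_four_le {n : ℕ} (y : Fin n → ℝ) :
    ∑ ε, signedSum ε y ^ 4 ≤ 3 * 2 ^ n * (∑ i, y i ^ 2) ^ 2 := by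
  induction n with
  | zero => simp [signedSum]
  | succ n ih =>
    rw [sum_bool_fun_succ, Fin.sum_univ_succ]
    have h : ∀ ε : Fin n → Bool, signedSum (Fin.cons true ε) y ^ 4
        + signedSum (Fin.cons false ε) y ^ 4
        = 2 * y 0 ^ 4 + 12 * y 0 ^ 2 * signedSum ε (fun i => y i.succ) ^ 2
          + 2 * signedSum ε (fun i => y i.succ) ^ 4 := by
      intro ε
      simp only [signedSum_cons, boolSign, if_true, Bool.false_eq_true, if_false]
      ring
    simp only [h, Finset.sum_add_distrib, ← Finset.mul_sum, sum_signedSum_sq]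
    have h1 := ih (fun i => y i.succ)
    set S := ∑ i : Fin n, y i.succ ^ 2
    have h2 : (0 : ℝ) ≤ 2 ^ n * y 0 ^ 4 := by positivity
    simp only [Finset.sum_const, Finset.card_univ, Fintype.card_fun, Fintype.card_bool,
      Fintype.card_fin, nsmul_eq_mul, Nat.cast_pow, Nat.cast_ofNat]
    rw [pow_succ' (2 : ℝ) n]
    nlinarith

/-- (1 - u + u²/2)(1 + u + u²/2) = 1 + u⁴/4 ≥ 1, and the second factor is at most exp u. -/
theorem Real.exp_neg_le_quadratic {u : ℝ} (hu : 0 ≤ u) :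
    Real.exp (-u) ≤ 1 - u + u ^ 2 / 2 := by
  have h1 := Real.quadratic_le_exp_of_nonneg hu
  rw [Real.exp_neg, inv_le_iff_one_le_mul₀ (Real.exp_pos u)]
  have h2 : 0 ≤ 1 - u + u ^ 2 / 2 := by nlinarith [sq_nonneg (u - 1)]
  nlinarith [mul_le_mul_of_nonneg_left h1 h2, sq_nonneg (u ^ 2)]

/-- With second moment S and fourth moment at most 3S², the quadratic bound on exp(-tX²) averages to
at most 1 - tS + 3t²S²/2, which is least at t = 1/(3S), with value 1 - 1/6. -/
theorem sum_exp_neg_signedSum_sq_le {n : ℕ} (y : Fin n → ℝ) (hy : 0 < ∑ i, y i ^ 2) :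
    ∑ ε, Real.exp (-(signedSum ε y ^ 2 / (3 * ∑ i, y i ^ 2))) ≤ 2 ^ n * Real.exp (-(1 / 6)) := by
  set S := ∑ i, y i ^ 2 with hS
  have h1 : ∀ ε : Fin n → Bool, Real.exp (-(signedSum ε y ^ 2 / (3 * S)))
      ≤ 1 - 1 / (3 * S) * signedSum ε y ^ 2 + 1 / (18 * S ^ 2) * signedSum ε y ^ 4 := by
    intro ε
    refine (Real.exp_neg_le_quadratic (by positivity)).trans (le_of_eq ?_)
    field_simp
    ring
  have h2 := sum_signedSum_sq y
  have h3 := sum_signedSum_pow_four_le y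
  rw [← hS] at h2 h3
  have h4 := mul_le_mul_of_nonneg_left h3 (by positivity : 0 ≤ 1 / (18 * S ^ 2))
  have h5 : -(1 / 6 : ℝ) + 1 ≤ Real.exp (-(1 / 6)) := Real.add_one_le_exp _
  calc _ ≤ ∑ ε : Fin n → Bool,
        (1 - 1 / (3 * S) * signedSum ε y ^ 2 + 1 / (18 * S ^ 2) * signedSum ε y ^ 4) :=
        Finset.sum_le_sum fun ε _ => h1 ε
    _ = 2 ^ n - 1 / (3 * S) * (2 ^ n * S) + 1 / (18 * S ^ 2) * ∑ ε, signedSum ε y ^ 4 := by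
        rw [Finset.sum_add_distrib, Finset.sum_sub_distrib, ← Finset.mul_sum, ← Finset.mul_sum, h2]
        simp
    _ ≤ 2 ^ n - 1 / (3 * S) * (2 ^ n * S) + 1 / (18 * S ^ 2) * (3 * 2 ^ n * S ^ 2) := by
        linarith
    _ = 2 ^ n * (-(1 / 6) + 1) := by
        field_simp
        ring
    _ ≤ _ := by gcongr

theorem card_sign_matrices_small_le {n d : ℕ} (y : Fin n → ℝ) :
    ((Finset.univ.filter fun M : Fin d → Fin n → Bool =>
      ∑ r, signedSum (M r) y ^ 2 < d / 4 * ∑ i, y i ^ 2).card : ℝ)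
      ≤ (2 ^ n) ^ d * Real.exp (-(d / 12)) := by
  set S := ∑ i, y i ^ 2 with hS
  have hS0 : 0 ≤ S := Finset.sum_nonneg fun i _ => sq_nonneg _
  rcases hS0.eq_or_lt with h0 | hpos
  · have : (Finset.univ.filter fun M : Fin d → Fin n → Bool =>
        ∑ r, signedSum (M r) y ^ 2 < d / 4 * S) = ∅ := by
      apply Finset.filter_false_of_mem
      intro M _
      rw [← h0, mul_zero, not_lt]
      exact Finset.sum_nonneg fun i _ => sq_nonneg _
    rw [this]
    simp only [Finset.card_empty, Nat.cast_zero]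
    positivity
  have key : ∑ M : Fin d → Fin n → Bool, ∏ r, Real.exp (-(signedSum (M r) y ^ 2 / (3 * S)))
      ≤ (2 ^ n * Real.exp (-(1 / 6))) ^ d := by
    rw [← Fintype.piFinset_univ, ← Finset.prod_univ_sum (fun _ : Fin d => Finset.univ)
      (fun _ (ε : Fin n → Bool) => Real.exp (-(signedSum ε y ^ 2 / (3 * S))))]
    rw [Finset.prod_const, Finset.card_univ, Fintype.card_fin]
    exact pow_le_pow_left₀ (Finset.sum_nonneg fun _ _ => (Real.exp_pos _).le)
      (sum_exp_neg_signedSum_sq_le y hpos) d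
  -- Markov's inequality: on the bad event the exponent exceeds -(d/4)/3 = -d/12.
  have h1 : ((Finset.univ.filter fun M : Fin d → Fin n → Bool =>
      ∑ r, signedSum (M r) y ^ 2 < d / 4 * S).card : ℝ) * Real.exp (-(d / 12))
      ≤ (2 ^ n * Real.exp (-(1 / 6))) ^ d := by
    refine le_trans ?_ key
    rw [← nsmul_eq_mul]
    refine (Finset.card_nsmul_le_sum _ _ _ ?_).trans
      (Finset.sum_le_univ_sum_of_nonneg fun M => Finset.prod_nonneg fun r _ => (Real.exp_pos _).le)
    intro M hM
    rw [← Real.exp_sum, Real.exp_le_exp, Finset.sum_neg_distrib, ← Finset.sum_div, neg_le_neg_iff,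
      div_le_iff₀ (by positivity)]
    have := (Finset.mem_filter.1 hM).2
    linarith
  rw [← le_div_iff₀ (Real.exp_pos _)] at h1
  refine h1.trans (le_of_eq ?_)
  rw [mul_pow, ← Real.exp_nat_mul, mul_div_assoc, ← Real.exp_sub]
  congr 2
  ring

/-- A finite family of vectors admits a sign matrix with `d` rows that shrinks none of them by more
than a factor `2`, as soon as `d` is large compared with the logarithm of the size of the family. -/
theorem exists_sign_matrix {ι : Type*} [Fintype ι] {n d : ℕ} (y : ι → Fin n → ℝ)
    (hcard : (Fintype.card ι : ℝ) < Real.exp (d / 12)) :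
    ∃ M : Fin d → Fin n → Bool, ∀ a,
      d / 4 * ∑ i, y a i ^ 2 ≤ ∑ r, signedSum (M r) (y a) ^ 2 := by
  classical
  by_contra! hcon
  have hcover : (Finset.univ : Finset (Fin d → Fin n → Bool)) ⊆
      Finset.univ.biUnion fun a => Finset.univ.filter fun M : Fin d → Fin n → Bool =>
        ∑ r, signedSum (M r) (y a) ^ 2 < d / 4 * ∑ i, y a i ^ 2 := by
    intro M _
    obtain ⟨a, ha⟩ := hcon M
    simpa using ⟨a, ha⟩
  have h1 := (Finset.card_le_card hcover).trans Finset.card_biUnion_le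
  have h2 : ((2 : ℝ) ^ n) ^ d ≤ Fintype.card ι * ((2 ^ n) ^ d * Real.exp (-(d / 12))) := by
    calc ((2 : ℝ) ^ n) ^ d = ((Finset.univ : Finset (Fin d → Fin n → Bool)).card : ℝ) := by
          simp
      _ ≤ ∑ a, ((Finset.univ.filter fun M : Fin d → Fin n → Bool =>
            ∑ r, signedSum (M r) (y a) ^ 2 < d / 4 * ∑ i, y a i ^ 2).card : ℝ) := by
          exact_mod_cast h1
      _ ≤ ∑ _a : ι, (2 ^ n) ^ d * Real.exp (-(d / 12)) :=
          Finset.sum_le_sum fun a _ => card_sign_matrices_small_le (y a)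
      _ = _ := by simp
  have h3 : (Fintype.card ι : ℝ) * Real.exp (-(d / 12)) < 1 := by
    rw [Real.exp_neg, ← div_eq_mul_inv, div_lt_one (Real.exp_pos _)]
    exact hcard
  have h4 : (0 : ℝ) < (2 ^ n) ^ d := by positivity
  nlinarith

/-! ### Perceptron argument -/

/-- The perceptron argument: vectors of norm at most `1` either have a common unit vector of margin
`ρ`, or some multiset of `m` of them has a sum of norm at most `2 * √m`. -/
theorem exists_multiset_norm_sum_sq_le {E ι : Type*} [NormedAddCommGroup E]
    [InnerProductSpace ℝ E] [Nonempty ι] (x : ι → E) (hx : ∀ i, ‖x i‖ ≤ 1) {ρ : ℝ}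
    (m : ℕ) (hm : 16 * ρ ^ 2 * m ≤ 9)
    (hmargin : ∀ u : E, ‖u‖ = 1 → ∃ i, inner ℝ u (x i) < ρ) :
    ∃ q : Multiset ι, q.card = m ∧ ‖(q.map x).sum‖ ^ 2 ≤ 4 * m := by
  induction m with
  | zero => exact ⟨0, by simp⟩
  | succ m ih =>
    push_cast at hm ⊢
    obtain ⟨q, hq, hle⟩ := ih (by nlinarith [sq_nonneg ρ])
    set w := (q.map x).sum
    obtain ⟨i, hi⟩ : ∃ i, inner ℝ w (x i) ≤ ρ * ‖w‖ := by
      by_cases hw : w = 0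
      · exact ⟨Classical.arbitrary ι, by simp [hw]⟩
      · have hw' : 0 < ‖w‖ := norm_pos_iff.2 hw
        obtain ⟨i, hi⟩ := hmargin (‖w‖⁻¹ • w) (by simp [norm_smul, hw'.ne'])
        refine ⟨i, ?_⟩
        rw [real_inner_smul_left, inv_mul_lt_iff₀ hw'] at hi
        linarith
    refine ⟨i ::ₘ q, by simp [hq], ?_⟩
    rw [Multiset.map_cons, Multiset.sum_cons, add_comm, norm_add_sq_real]
    have h1 : ‖x i‖ ^ 2 ≤ 1 := pow_le_one₀ (norm_nonneg _) (hx i)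
    -- The cross term 2ρ‖w‖ is then at most 3, so each step adds at most 3 + 1 = 4.
    have h2 : ρ * ‖w‖ ≤ 3 / 2 := by
      refine abs_le_of_sq_le_sq' ?_ (by norm_num) |>.2
      nlinarith [mul_le_mul_of_nonneg_left hle (sq_nonneg ρ), sq_nonneg ρ]
    linarith

/-! ### Counting bounds and the norm of signed sums of columns -/

theorem choose_le_exp_mul_div_pow (N m : ℕ) :
    (N.choose m : ℝ) ≤ (Real.exp 1 * (N / m)) ^ m := by
  rcases Nat.eq_zero_or_pos m with rfl | hm
  · simp
  have hm' : (0 : ℝ) < m := by exact_mod_cast hm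
  have h1 : (N.choose m : ℝ) ≤ N ^ m / m.factorial := Nat.choose_le_pow_div m N
  have h2 : (m : ℝ) ^ m / m.factorial ≤ Real.exp m := Real.pow_div_factorial_le_exp m hm'.le m
  have h3 : Real.exp 1 ^ m = Real.exp m := by rw [← Real.exp_nat_mul, mul_one]
  calc (N.choose m : ℝ) ≤ N ^ m / m.factorial := h1
    _ = (m : ℝ) ^ m / m.factorial * (N / m) ^ m := by
        rw [div_pow]; field_simp
    _ ≤ Real.exp m * (N / m) ^ m := by gcongr
    _ = _ := by rw [mul_pow, h3]

theorem choose_le_exp_of_le {N m : ℕ} {L : ℝ} (hL : 1 ≤ L) (h : (N : ℝ) / m ≤ Real.exp L) :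
    (N.choose m : ℝ) ≤ Real.exp (2 * m * L) := by
  refine (choose_le_exp_mul_div_pow N m).trans ?_
  have : Real.exp (2 * m * L) = (Real.exp L * Real.exp L) ^ m := by
    rw [← Real.exp_add, ← Real.exp_nat_mul]; congr 1; ring
  rw [this]
  gcongr

/-- The vector of multiplicities in `q`, with positive sign on `T` and negative sign off `T`. -/
def signedCount {n : ℕ} (T : Finset (Fin n)) (q : Multiset (Fin n)) (i : Fin n) : ℝ :=
  if i ∈ T then (q.count i : ℝ) else -(q.count i : ℝ)

theorem sum_count_eq_card {n : ℕ} (q : Multiset (Fin n)) : ∑ i, (q.count i : ℝ) = q.card := by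
  exact_mod_cast Multiset.sum_count_eq_card (s := Finset.univ) (m := q) (by simp)

/-- Let m = 289k and let a be the mass of `q` on T. If a ≤ m/3, the coordinate sum 2a - m gives
m²/18 > 4m. If a > m/3, Cauchy–Schwarz on the k indices of T gives m²/(72k) = (289/72)m > 4m; this
is why the factor must exceed 288. -/
theorem lower_bound_signedCount {n k : ℕ} (hk : 1 ≤ k) (T : Finset (Fin n)) (hT : T.card = k)
    (q : Multiset (Fin n)) (hq : q.card = 289 * k) :
    4 * (q.card : ℝ) <
      1 / 2 * (∑ i, signedCount T q i) ^ 2 + 1 / 8 * ∑ i, signedCount T q i ^ 2 := by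
  set a : ℝ := ∑ i ∈ T, (q.count i : ℝ) with ha
  have hk' : (1 : ℝ) ≤ k := by exact_mod_cast hk
  have hm : (q.card : ℝ) = 289 * k := by rw [hq]; push_cast; ring
  have hsum : ∑ i, signedCount T q i = 2 * a - q.card := by
    have h : ∀ i, signedCount T q i = 2 * (if i ∈ T then (q.count i : ℝ) else 0) - q.count i := by
      intro i
      unfold signedCount
      split_ifs <;> ring
    simp only [h, Finset.sum_sub_distrib, ← Finset.mul_sum, sum_count_eq_card]
    simp [ha]
  have hsq : a ^ 2 ≤ k * ∑ i, signedCount T q i ^ 2 := by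
    have h1 : a ^ 2 ≤ k * ∑ i ∈ T, (q.count i : ℝ) ^ 2 := by
      rw [← hT]
      exact sq_sum_le_card_mul_sum_sq
    refine h1.trans (mul_le_mul_of_nonneg_left ?_ (by positivity))
    calc ∑ i ∈ T, (q.count i : ℝ) ^ 2 = ∑ i ∈ T, signedCount T q i ^ 2 :=
          Finset.sum_congr rfl fun i hi => by simp [signedCount, hi]
      _ ≤ _ := Finset.sum_le_univ_sum_of_nonneg fun i => sq_nonneg _
  have hA : 0 ≤ ∑ i, signedCount T q i ^ 2 := Finset.sum_nonneg fun i _ => sq_nonneg _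
  have ha0 : 0 ≤ a := Finset.sum_nonneg fun i _ => Nat.cast_nonneg _
  rw [hsum, hm]
  set A := ∑ i, signedCount T q i ^ 2
  rcases le_or_gt (3 * a) (289 * k) with h | h
  · have : (289 * k / 3 : ℝ) ^ 2 ≤ (2 * a - 289 * k) ^ 2 := by
      nlinarith [mul_nonneg (sub_nonneg.2 h) (by linarith : (0 : ℝ) ≤ 2 * (289 * k) - 3 * a)]
    nlinarith
  · have h1 : (289 * k / 3 : ℝ) ^ 2 < a ^ 2 := by
      apply pow_lt_pow_left₀ <;> linarith
    have h2 : (289 / 3 : ℝ) ^ 2 * k < A := by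
      by_contra! hc
      nlinarith
    nlinarith [sq_nonneg (2 * a - 289 * k)]

/-- The unit vector with first coordinate `1 / √2` whose other coordinates are proportional to the
`i`-th column of the sign matrix `M`. -/
noncomputable def liftedColumn {n d : ℕ} (M : Fin d → Fin n → Bool) (i : Fin n) :
    EuclideanSpace ℝ (Fin (d + 1)) :=
  WithLp.toLp 2 (Fin.cons (1 / √2) fun r => boolSign (M r i) / √(2 * d))

theorem norm_liftedColumn {n d : ℕ} (hd : 0 < d) (M : Fin d → Fin n → Bool) (i : Fin n) :
    ‖liftedColumn M i‖ = 1 := by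
  have hd' : (0 : ℝ) < d := by exact_mod_cast hd
  rw [← sq_eq_sq₀ (norm_nonneg _) zero_le_one, EuclideanSpace.real_norm_sq_eq, Fin.sum_univ_succ]
  simp only [liftedColumn, Fin.cons_zero, Fin.cons_succ, div_pow, boolSign_sq]
  rw [Real.sq_sqrt (by positivity), Real.sq_sqrt (by positivity)]
  simp
  field_simp
  norm_num

theorem norm_sq_sum_smul_liftedColumn {n d : ℕ} (M : Fin d → Fin n → Bool) (y : Fin n → ℝ) :
    ‖∑ i, y i • liftedColumn M i‖ ^ 2
      = 1 / 2 * (∑ i, y i) ^ 2 + 1 / (2 * d) * ∑ r, signedSum (M r) y ^ 2 := by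
  rw [EuclideanSpace.real_norm_sq_eq, Fin.sum_univ_succ]
  congr 1
  · simp [liftedColumn, ← Finset.sum_mul, mul_pow]
    ring
  · rw [Finset.mul_sum]
    refine Finset.sum_congr rfl fun r _ => ?_
    have h : (∑ i, y i • liftedColumn M i).ofLp r.succ = signedSum (M r) y / √(2 * d) := by
      simp only [WithLp.ofLp_sum, WithLp.ofLp_smul, Finset.sum_apply, Pi.smul_apply, liftedColumn,
        Fin.cons_succ, smul_eq_mul, signedSum, Finset.sum_div]
      exact Finset.sum_congr rfl fun i _ => by ring
    rw [h, div_pow, Real.sq_sqrt (by positivity)]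
    ring

theorem sum_map_smul_eq {n : ℕ} {E : Type*} [AddCommGroup E] [Module ℝ E] (T : Finset (Fin n))
    (V : Fin n → E) (q : Multiset (Fin n)) :
    (q.map fun i => (if i ∈ T then (1 : ℝ) else -1) • V i).sum = ∑ i, signedCount T q i • V i := by
  rw [Finset.sum_multiset_map_count]
  refine (Finset.sum_subset (Finset.subset_univ _) ?_).trans (Finset.sum_congr rfl ?_)
  · intro i _ hi
    rw [Multiset.mem_toFinset] at hi
    simp [Multiset.count_eq_zero_of_notMem hi]
  · intro i _
    unfold signedCount
    split_ifs <;> simp [← Nat.cast_smul_eq_nsmul ℝ]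

/-- The sets contribute 2k and the multisets 2 · 289k to the factor 580k. -/
theorem card_pairs_le {n k : ℕ} (hk : 1 ≤ k) (hn : 8 * k < n) :
    ((Fintype.card ({T : Finset (Fin n) // T.card = k} × Sym (Fin n) (289 * k)) : ℕ) : ℝ)
      ≤ Real.exp (580 * k * Real.log (n / k)) := by
  have hk' : (1 : ℝ) ≤ k := by exact_mod_cast hk
  have hn' : (8 * k : ℝ) < n := by exact_mod_cast hn
  have h8 : (8 : ℝ) ≤ n / k := by rw [le_div_iff₀ (by linarith)]; exact hn'.le
  have hL : 1 ≤ Real.log (n / k) := by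
    rw [Real.le_log_iff_exp_le (by linarith)]
    linarith [Real.exp_one_lt_d9]
  have hexp : Real.exp (Real.log (n / k)) = n / k := Real.exp_log (by linarith)
  rw [Fintype.card_prod, Fintype.card_finset_len, Fintype.card_fin, Sym.card_sym_eq_choose,
    Fintype.card_fin, Nat.cast_mul]
  have h1 := choose_le_exp_of_le (N := n) (m := k) hL hexp.ge
  have h2 := choose_le_exp_of_le (N := n + 289 * k - 1) (m := 289 * k) hL (by
    rw [hexp]
    have : ((n + 289 * k - 1 : ℕ) : ℝ) ≤ n + 289 * k := by
      exact_mod_cast Nat.sub_le _ _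
    push_cast
    rw [div_le_div_iff₀ (by linarith) (by linarith)]
    nlinarith)
  calc _ ≤ _ := mul_le_mul h1 h2 (Nat.cast_nonneg _) (Real.exp_pos _).le
    _ = _ := by
      rw [← Real.exp_add]
      push_cast
      congr 1
      ring

/-! ### The sparse and dense cases, and their combination -/

theorem exists_embedding_of_sparse {n k d : ℕ} (hk : 1 ≤ k) (hn : 8 * k < n)
    (hd : 20000 * k * Real.log (n / k) ≤ d) :
    ∃ (U : {T : Finset (Fin n) // T.card = k} → EuclideanSpace ℝ (Fin d))
      (V : Fin n → EuclideanSpace ℝ (Fin d)),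
      IsMarginEmbedding (topKMatrix n k) U V (1 / 32 / √k) 0 := by
  have hk' : (1 : ℝ) ≤ k := by exact_mod_cast hk
  have hn' : (8 * k : ℝ) < n := by exact_mod_cast hn
  have h8 : (8 : ℝ) ≤ n / k := by rw [le_div_iff₀ (by linarith)]; exact hn'.le
  have hL : 1 ≤ Real.log (n / k) := by
    rw [Real.le_log_iff_exp_le (by linarith)]
    linarith [Real.exp_one_lt_d9]
  have hkL : 1 ≤ k * Real.log (n / k) := one_le_mul_of_one_le_of_one_le hk' hL
  have hd2 : (20000 : ℝ) ≤ d := by nlinarith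
  -- One dimension is reserved for the constant coordinate.
  obtain ⟨d, rfl⟩ : ∃ e, d = e + 1 := Nat.exists_eq_succ_of_ne_zero (by
    rintro rfl
    norm_num at hd2)
  push_cast at hd hd2
  have hd0 : (0 : ℝ) < d := by linarith
  obtain ⟨M, hM⟩ := exists_sign_matrix (d := d)
    (fun a : {T : Finset (Fin n) // T.card = k} × Sym (Fin n) (289 * k) =>
      signedCount a.1.1 (a.2 : Multiset (Fin n)))
    ((card_pairs_le hk hn).trans_lt (by
      rw [Real.exp_lt_exp]
      nlinarith))
  have hex : ∀ T : {T : Finset (Fin n) // T.card = k}, ∃ u : EuclideanSpace ℝ (Fin (d + 1)),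
      ‖u‖ = 1 ∧ ∀ i, 1 / 32 / √k ≤
        inner ℝ u ((if i ∈ T.1 then (1 : ℝ) else -1) • liftedColumn M i) := by
    intro T
    by_contra! hcon
    have : Nonempty (Fin n) := ⟨⟨0, by omega⟩⟩
    obtain ⟨q, hq, hle⟩ := exists_multiset_norm_sum_sq_le
      (fun i => (if i ∈ T.1 then (1 : ℝ) else -1) • liftedColumn M i)
      (fun i => by
        rw [norm_smul, norm_liftedColumn (by exact_mod_cast hd0)]
        split_ifs <;> simp)
      (289 * k) (by
        rw [div_pow, Real.sq_sqrt (by positivity)]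
        push_cast
        field_simp
        norm_num) hcon
    have h1 := lower_bound_signedCount hk T.1 T.2 q hq
    have h2 : d / 4 * ∑ i, signedCount T.1 q i ^ 2
      ≤ ∑ r, signedSum (M r) (signedCount T.1 q) ^ 2 := hM (T, ⟨q, hq⟩)
    rw [sum_map_smul_eq, norm_sq_sum_smul_liftedColumn, ← hq] at hle
    have h3 := mul_le_mul_of_nonneg_left h2 (by positivity : (0 : ℝ) ≤ 1 / (2 * d))
    have h4 : 1 / (2 * d) * (d / 4 * ∑ i, signedCount T.1 q i ^ 2)
        = 1 / 8 * ∑ i, signedCount T.1 q i ^ 2 := by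
      field_simp
      ring
    linarith
  choose U hU1 hU using hex
  refine ⟨U, liftedColumn M, by positivity, hU1, norm_liftedColumn (by exact_mod_cast hd0) M,
    fun T i h => ?_, fun T i h => ?_⟩
  · have hi : i ∈ T.1 := by
      by_contra hi
      simp [topKMatrix, hi] at h
    simpa [hi] using hU T i
  · have hi : i ∉ T.1 := by
      intro hi
      simp [topKMatrix, hi] at h
    have := hU T i
    simp only [hi, if_false, neg_smul, one_smul, inner_neg_right] at this
    linarith

theorem exists_embedding_of_dense {n k d : ℕ} (hk : 1 ≤ k) (hn : n ≤ 8 * k) (hn0 : 0 < n)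
    (hd : n ≤ d) :
    ∃ (U : {T : Finset (Fin n) // T.card = k} → EuclideanSpace ℝ (Fin d))
      (V : Fin n → EuclideanSpace ℝ (Fin d)),
      IsMarginEmbedding (topKMatrix n k) U V (1 / 32 / √k) 0 := by
  have hk' : (1 : ℝ) ≤ k := by exact_mod_cast hk
  have hn' : (0 : ℝ) < n := by exact_mod_cast hn0
  let V : Fin n → EuclideanSpace ℝ (Fin d) := fun i =>
    EuclideanSpace.single (Fin.castLE hd i) (1 : ℝ)
  have hV : Orthonormal ℝ V :=
    (EuclideanSpace.orthonormal_single (𝕜 := ℝ) (ι := Fin d)).comp _ (Fin.castLE_injective hd)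
  let s : Finset (Fin n) → Fin n → ℝ := fun T i => if i ∈ T then 1 / √n else -(1 / √n)
  have hs : ∀ T i, s T i * s T i = 1 / n := by
    intro T i
    simp only [s]
    split_ifs <;> simp [← mul_inv, Real.mul_self_sqrt hn'.le]
  have hmargin : 1 / 32 / √k ≤ 1 / √n := by
    have h1 : √(n : ℝ) ≤ 32 * √k := by
      rw [Real.sqrt_le_left (by positivity), mul_pow, Real.sq_sqrt (by positivity)]
      have : (n : ℝ) ≤ 8 * k := by exact_mod_cast hn
      linarith
    rw [div_div]
    exact one_div_le_one_div_of_le (by positivity) h1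
  have hinner : ∀ T i, inner ℝ (∑ j, s T j • V j) (V i) = s T i := by
    intro T i
    simpa using hV.inner_left_fintype (s T) i
  refine ⟨fun T => ∑ j, s T.1 j • V j, V, by positivity, fun T => ?_, hV.1, fun T i h => ?_,
    fun T i h => ?_⟩
  · rw [← sq_eq_sq₀ (norm_nonneg _) zero_le_one, ← real_inner_self_eq_norm_sq,
      hV.inner_sum]
    simp [hs, hn'.ne']
  · rw [hinner]
    have hi : i ∈ T.1 := by
      by_contra hi
      simp [topKMatrix, hi] at h
    simpa [s, hi] using hmargin
  · rw [hinner]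
    have hi : i ∉ T.1 := by
      intro hi
      simp [topKMatrix, hi] at h
    simpa [s, hi] using hmargin

theorem mainTheorem12 :
    ∃ c : ℝ, 0 < c ∧ ∀ γ : ℝ, γ < 1 → ∃ C : ℝ, 0 < C ∧
      ∀ n k d : ℕ, 1 ≤ k → (k : ℝ) ≤ γ * (n : ℝ) →
        C * (k : ℝ) * Real.log ((n : ℝ) / (k : ℝ)) ≤ (d : ℝ) →
        ∃ (U : {T : Finset (Fin n) // T.card = k} → EuclideanSpace ℝ (Fin d))
          (V : Fin n → EuclideanSpace ℝ (Fin d)),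
          IsMarginEmbedding (topKMatrix n k) U V (c / Real.sqrt (k : ℝ)) 0 := by
  refine ⟨1 / 32, by norm_num, fun γ hγ =>
    -- The second term forces d ≥ 8k ≥ n in the dense case, since log(n/k) ≥ log(1/γ). The first
    -- keeps the constant positive even for γ ≤ 0, where the claim is vacuous.
    ⟨max 20000 (8 / Real.log (1 / γ)), by positivity, fun n k d hk hkn hd => ?_⟩⟩
  have hk' : (1 : ℝ) ≤ k := by exact_mod_cast hk
  have hn' : (0 : ℝ) < n := by
    rcases Nat.eq_zero_or_pos n with rfl | h
    · norm_num at hkn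
      omega
    · exact_mod_cast h
  have hγ0 : 0 < γ := by
    by_contra! h
    nlinarith
  have hlogγ : 0 < Real.log (1 / γ) := Real.log_pos (by rw [lt_div_iff₀ hγ0]; linarith)
  have hlog : Real.log (1 / γ) ≤ Real.log (n / k) := by
    apply Real.log_le_log (by positivity)
    rw [div_le_div_iff₀ hγ0 (by linarith)]
    linarith
  have hkL : 0 ≤ k * Real.log (n / k) := by
    have := hlogγ.le.trans hlog
    positivity
  rw [mul_assoc] at hd
  rcases le_or_gt n (8 * k) with h | h
  · refine exists_embedding_of_dense hk h (by exact_mod_cast hn') ?_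
    have h1 := (mul_le_mul_of_nonneg_right (le_max_right 20000 (8 / Real.log (1 / γ))) hkL).trans hd
    have h2 : (8 * k : ℝ) ≤ 8 / Real.log (1 / γ) * (k * Real.log (n / k)) := by
      rw [div_mul_eq_mul_div, le_div_iff₀ hlogγ]
      have := mul_le_mul_of_nonneg_left hlog (by positivity : (0 : ℝ) ≤ 8 * k)
      linarith
    exact h.trans (by exact_mod_cast h2.trans h1)
  · refine exists_embedding_of_sparse hk h ?_
    rw [mul_assoc]
    exact (mul_le_mul_of_nonneg_right (le_max_left _ _) hkL).trans hd
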